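/- Let $\Sigma$ be a finite alphabet. A probabilistic automaton $\mathcal A=(S,\Sigma,M,\pi,F)$ consists of a finite set $S$ of states, a probability vector $\pi\in\mathbb R^S$ (the initial distribution), non-negative matrices $M(a)\in\mathbb R^{S\times S}$ for $a\in\Sigma$, and a vector $F\in[0,1]^S$ such that one of the following holds: (acceptor) every $M(a)$ has unit row sums and $F$ is the indicator vector of a set of final states; or (generator of words) $F_s+\sum_{a\in\Sigma}\sum_{t\in S}M(a)_{st}=1$ for every $s\in S$. It assigns to each word $v=v_1\cdots v_\ell\in\Sigma^*$ the probability $p_{\mathcal A}(v)=\pi^{T}M(v_1)\cdots M(v_\ell)F$. Two probabilistic automata $\mathcal A_1,\mathcal A_2$ over $\Sigma$ are equivalent if $p_{\mathcal A_1}(v)=p_{\mathcal A_2}(v)$ for all $v\in\Sigma^*$. There is an algorithm that, given two probabilistic automata $\mathcal A_1=(S_1,\Sigma,M_1,\pi_1,F_1)$ and $\mathcal A_2=(S_2,\Sigma,M_2,\pi_2,F_2)$ with $N_1=|S_1|$ and $N_2=|S_2|$, decides whether they are equivalent in $O\big((|\Sigma|+1)N^4\big)$ operations, where $N=\max(N_1,N_2)$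 and the implied constant is absolute. Here an algorithm is a single program for a random access machine over $\mathbb R$ with exact arithmetic, and every arithmetic operation ($+,-,\times,/$), comparison, memory access and control step, on real numbers or on natural-number addresses and counters, counts as one operation. -/

import Mathlib

/-! ### Probabilistic automata -/

/-- The data `(S, Σ, M, π, F)` of a finite automaton with real weights, where `Σ = Fin k` and
`S = Fin N`: one transition matrix per symbol, an initial vector and a vector of final weights. -/
structure Automaton (k N : ℕ) where
  trans : Fin k → Matrix (Fin N) (Fin N) ℝ
  init : Fin N → ℝ
  final : Fin N → ℝ

namespace Automaton

variable {k N : ℕ}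

/-- The weights are those of a probabilistic acceptor: on reading `a` in state `s` the automaton
moves to `t` with probability `trans a s t`, and it accepts in the states of a set `F`. -/
def IsAcceptor (A : Automaton k N) : Prop :=
  ((∀ s, 0 ≤ A.init s) ∧ ∑ s, A.init s = 1) ∧
  (∀ a s, (∀ t, 0 ≤ A.trans a s t) ∧ ∑ t, A.trans a s t = 1) ∧
  ∃ F : Set (Fin N), A.final = F.indicator 1

/-- The weights are those of a probabilistic generator of finite words: in state `s` the automaton
stops with probability `final s`, or emits `a` and moves to `t` with probability `trans a s t`. -/
def IsGenerator (A : Automaton k N) : Prop :=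
  ((∀ s, 0 ≤ A.init s) ∧ ∑ s, A.init s = 1) ∧
  (∀ a s t, 0 ≤ A.trans a s t) ∧ (∀ s, 0 ≤ A.final s) ∧
  ∀ s, A.final s + ∑ a, ∑ t, A.trans a s t = 1

/-- Probabilistic automata, in either of the two usual senses. -/
def IsProbabilistic (A : Automaton k N) : Prop :=
  A.IsAcceptor ∨ A.IsGenerator

/-- The probability `π M(v₁) ⋯ M(vₜ) F` of the word `v`. -/
def wordProb (A : Automaton k N) (v : List (Fin k)) : ℝ :=
  A.init ⬝ᵥ ((v.map A.trans).prod).mulVec A.final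

/-- Two automata over the same alphabet are equivalent if every finite word has the same
probability under both. -/
def Equivalent {N₁ N₂ : ℕ} (A₁ : Automaton k N₁) (A₂ : Automaton k N₂) : Prop :=
  ∀ v : List (Fin k), A₁.wordProb v = A₂.wordProb v

end Automaton

/-! ### A real random access machine

Programs have finitely many registers holding natural numbers (used as counters and addresses) and
finitely many arrays of real numbers. Every arithmetic operation, comparison, memory access,
constant, assignment and branching has cost one. -/

namespace RealRAM

/-- `reg x` is the content of register `x`, and `arr m i` is the `i`-th cell of array `m`. -/
structure State where
  reg : ℕ → ℕ
  arr : ℕ → ℕ → ℝ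

/-- Expressions for natural numbers; `sub` is truncated subtraction. -/
inductive NatExpr where
  | lit (n : ℕ)
  | reg (x : ℕ)
  | add (e f : NatExpr)
  | sub (e f : NatExpr)
  | mul (e f : NatExpr)

/-- Expressions for real numbers; `cell m i` reads the cell of array `m` at address `i`. -/
inductive RealExpr where
  | lit (q : ℚ)
  | cell (m : ℕ) (i : NatExpr)
  | add (e f : RealExpr)
  | sub (e f : RealExpr)
  | mul (e f : RealExpr)
  | div (e f : RealExpr)

/-- Tests. -/
inductive Test where
  | natEq (e f : NatExpr)
  | natLt (e f : NatExpr)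
  | realEq (e f : RealExpr)
  | realLt (e f : RealExpr)
  | neg (b : Test)
  | conj (b c : Test)

/-- Programs. -/
inductive Program where
  | skip
  | setReg (x : ℕ) (e : NatExpr)
  | setCell (m : ℕ) (i : NatExpr) (e : RealExpr)
  | seq (P Q : Program)
  | branch (b : Test) (P Q : Program)
  | loop (b : Test) (P : Program)

namespace NatExpr

/-- The value of an expression. -/
def eval (σ : State) : NatExpr → ℕ
  | lit n => n
  | reg x => σ.reg x
  | add e f => e.eval σ + f.eval σ
  | sub e f => e.eval σ - f.eval σ
  | mul e f => e.eval σ * f.eval σ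

/-- The cost of evaluating an expression. -/
def cost : NatExpr → ℕ
  | lit _ => 1
  | reg _ => 1
  | add e f => e.cost + f.cost + 1
  | sub e f => e.cost + f.cost + 1
  | mul e f => e.cost + f.cost + 1

end NatExpr

namespace RealExpr

/-- The value of an expression. -/
noncomputable def eval (σ : State) : RealExpr → ℝ
  | lit q => (q : ℝ)
  | cell m i => σ.arr m (i.eval σ)
  | add e f => e.eval σ + f.eval σ
  | sub e f => e.eval σ - f.eval σ
  | mul e f => e.eval σ * f.eval σ
  | div e f => e.eval σ / f.eval σ

/-- No division by zero occurs in the evaluation. -/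
def Valid (σ : State) : RealExpr → Prop
  | lit _ => True
  | cell _ _ => True
  | add e f => e.Valid σ ∧ f.Valid σ
  | sub e f => e.Valid σ ∧ f.Valid σ
  | mul e f => e.Valid σ ∧ f.Valid σ
  | div e f => e.Valid σ ∧ f.Valid σ ∧ f.eval σ ≠ 0

/-- The cost of evaluating an expression. -/
def cost : RealExpr → ℕ
  | lit _ => 1
  | cell _ i => i.cost + 1
  | add e f => e.cost + f.cost + 1
  | sub e f => e.cost + f.cost + 1
  | mul e f => e.cost + f.cost + 1
  | div e f => e.cost + f.cost + 1

end RealExpr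

namespace Test

/-- The outcome of a test. -/
def Holds (σ : State) : Test → Prop
  | natEq e f => e.eval σ = f.eval σ
  | natLt e f => e.eval σ < f.eval σ
  | realEq e f => e.eval σ = f.eval σ
  | realLt e f => e.eval σ < f.eval σ
  | neg b => ¬ b.Holds σ
  | conj b c => b.Holds σ ∧ c.Holds σ

/-- No division by zero occurs in the evaluation. -/
def Valid (σ : State) : Test → Prop
  | natEq _ _ => True
  | natLt _ _ => True
  | realEq e f => e.Valid σ ∧ f.Valid σ
  | realLt e f => e.Valid σ ∧ f.Valid σ
  | neg b => b.Valid σ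
  | conj b c => b.Valid σ ∧ c.Valid σ

/-- The cost of evaluating a test. -/
def cost : Test → ℕ
  | natEq e f => e.cost + f.cost + 1
  | natLt e f => e.cost + f.cost + 1
  | realEq e f => e.cost + f.cost + 1
  | realLt e f => e.cost + f.cost + 1
  | neg b => b.cost + 1
  | conj b c => b.cost + c.cost + 1

end Test

/-- Overwrite register `x`. -/
def State.setReg (σ : State) (x n : ℕ) : State :=
  { σ with reg := Function.update σ.reg x n }

/-- Overwrite cell `i` of array `m`. -/
def State.setCell (σ : State) (m i : ℕ) (r : ℝ) : State :=
  { σ with arr := Function.update σ.arr m (Function.update (σ.arr m) i r) }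

/-- `Exec P σ τ t`: started in `σ`, the program `P` halts in the state `τ` after a computation of
total cost `t`. A division by zero has no continuation. -/
inductive Exec : Program → State → State → ℕ → Prop
  | skip (σ : State) : Exec .skip σ σ 1
  | setReg (σ : State) (x : ℕ) (e : NatExpr) :
      Exec (.setReg x e) σ (σ.setReg x (e.eval σ)) (e.cost + 1)
  | setCell (σ : State) (m : ℕ) (i : NatExpr) (e : RealExpr) (he : e.Valid σ) :
      Exec (.setCell m i e) σ (σ.setCell m (i.eval σ) (e.eval σ)) (i.cost + e.cost + 1)
  | seq {P Q : Program} {σ τ υ : State} {t u : ℕ} (hP : Exec P σ τ t) (hQ : Exec Q τ υ u) :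
      Exec (.seq P Q) σ υ (t + u)
  | branch_true {b : Test} {P Q : Program} {σ τ : State} {t : ℕ}
      (hv : b.Valid σ) (hb : b.Holds σ) (hP : Exec P σ τ t) :
      Exec (.branch b P Q) σ τ (b.cost + 1 + t)
  | branch_false {b : Test} {P Q : Program} {σ τ : State} {t : ℕ}
      (hv : b.Valid σ) (hb : ¬ b.Holds σ) (hQ : Exec Q σ τ t) :
      Exec (.branch b P Q) σ τ (b.cost + 1 + t)
  | loop_done {b : Test} {P : Program} {σ : State}
      (hv : b.Valid σ) (hb : ¬ b.Holds σ) :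
      Exec (.loop b P) σ σ (b.cost + 1)
  | loop_step {b : Test} {P : Program} {σ τ υ : State} {t u : ℕ}
      (hv : b.Valid σ) (hb : b.Holds σ) (hP : Exec P σ τ t) (hL : Exec (.loop b P) τ υ u) :
      Exec (.loop b P) σ υ (b.cost + 1 + t + u)

/-- Computations are deterministic, so result and cost are functions of program and input. -/
theorem Exec.deterministic {P : Program} {σ τ τ' : State} {t t' : ℕ}
    (h : Exec P σ τ t) (h' : Exec P σ τ' t') : τ = τ' ∧ t = t' := by
  induction h generalizing τ' t' with
  | skip => cases h'; exact ⟨rfl, rfl⟩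
  | setReg => cases h'; exact ⟨rfl, rfl⟩
  | setCell => cases h'; exact ⟨rfl, rfl⟩
  | seq _ _ ihP ihQ =>
    cases h' with
    | seq hP' hQ' =>
      obtain ⟨rfl, rfl⟩ := ihP hP'
      obtain ⟨rfl, rfl⟩ := ihQ hQ'
      exact ⟨rfl, rfl⟩
  | branch_true _ hb _ ih =>
    cases h' with
    | branch_true _ _ hP' => obtain ⟨rfl, rfl⟩ := ih hP'; exact ⟨rfl, rfl⟩
    | branch_false _ hb' _ => exact absurd hb hb'
  | branch_false _ hb _ ih =>
    cases h' with
    | branch_true _ hb' _ => exact absurd hb' hb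
    | branch_false _ _ hQ' => obtain ⟨rfl, rfl⟩ := ih hQ'; exact ⟨rfl, rfl⟩
  | loop_done _ hb =>
    cases h' with
    | loop_done => exact ⟨rfl, rfl⟩
    | loop_step _ hb' _ _ => exact absurd hb' hb
  | loop_step _ hb _ _ ihP ihL =>
    cases h' with
    | loop_done _ hb' => exact absurd hb hb'
    | loop_step _ _ hP' hL' =>
      obtain ⟨rfl, rfl⟩ := ihP hP'
      obtain ⟨rfl, rfl⟩ := ihL hL'
      exact ⟨rfl, rfl⟩

/-- A finite vector as the content of an array, filled up with zeros. -/
def vecArray {n : ℕ} (f : Fin n → ℝ) (i : ℕ) : ℝ :=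
  if h : i < n then f ⟨i, h⟩ else 0

/-- The transition matrices as the content of one array: the entry `trans a s t` is stored at
address `(a * N + s) * N + t`. -/
def transArray {k N : ℕ} (M : Fin k → Matrix (Fin N) (Fin N) ℝ) : ℕ → ℝ :=
  vecArray fun j : Fin (k * N * N) => M j.divNat.divNat j.divNat.modNat j.modNat

theorem transArray_apply {k N : ℕ} (M : Fin k → Matrix (Fin N) (Fin N) ℝ)
    (a : Fin k) (s t : Fin N) :
    transArray M ((a * N + s) * N + t) = M a s t := by
  have hN : 0 < N := s.pos
  have h1 : (a : ℕ) * N + s < k * N := by nlinarith [a.isLt, s.isLt]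
  have h2 : ((a : ℕ) * N + s) * N + t < k * N * N := by nlinarith [t.isLt]
  have e1 : (((a : ℕ) * N + s) * N + t) / N = a * N + s := by
    rw [Nat.add_comm, Nat.add_mul_div_right _ _ hN, Nat.div_eq_of_lt t.isLt, Nat.zero_add]
  have e2 : ((a : ℕ) * N + s) / N = a := by
    rw [Nat.add_comm, Nat.add_mul_div_right _ _ hN, Nat.div_eq_of_lt s.isLt, Nat.zero_add]
  have ha : (⟨_, h2⟩ : Fin (k * N * N)).divNat.divNat = a := by
    ext; simp [Fin.coe_divNat, e1, e2]
  have hs : (⟨_, h2⟩ : Fin (k * N * N)).divNat.modNat = s := by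
    ext; simp [Fin.coe_divNat, Fin.coe_modNat, e1, Nat.mod_eq_of_lt s.isLt]
  have ht : (⟨_, h2⟩ : Fin (k * N * N)).modNat = t := by
    ext; simp [Fin.coe_modNat, Nat.mod_eq_of_lt t.isLt]
  simp only [transArray, vecArray, dif_pos h2, ha, hs, ht]

/-- The initial state for the input `(A₁, A₂)`: registers 0, 1, 2 hold the size of the alphabet and
the two numbers of states, arrays 0 to 5 hold the weights, and everything else is zero. -/
def input {k N₁ N₂ : ℕ} (A₁ : Automaton k N₁) (A₂ : Automaton k N₂) : State where
  reg
    | 0 => k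
    | 1 => N₁
    | 2 => N₂
    | _ => 0
  arr
    | 0 => vecArray A₁.init
    | 1 => vecArray A₁.final
    | 2 => transArray A₁.trans
    | 3 => vecArray A₂.init
    | 4 => vecArray A₂.final
    | 5 => transArray A₂.trans
    | _ => fun _ => 0

/-- The answer of a halted computation: yes is 1 and no is 0 in register 0. -/
def Answers (τ : State) (p : Prop) : Prop :=
  (p ∧ τ.reg 0 = 1) ∨ (¬ p ∧ τ.reg 0 = 0)

end RealRAM

/-!
Put the two automata side by side and negate the final weights of the second one: the automata are
equivalent if and only if the resulting weighted automaton, with `d = N₁ + N₂` states, assigns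
weight zero to every word, i.e. if and only if its final vector is orthogonal to the span of the row
vectors `π M(v₁) ⋯ M(vₜ)`. This span is the smallest space that contains `π` and is closed under
all `M(a)`. Gram–Schmidt yields an orthogonal basis of it: start with `π`, and for each basis vector
in turn, including those found on the way, insert its images under the `M(a)`, each of which either
contributes a new basis vector or reduces to zero. As there are at most `d` basis vectors and an
insertion takes `O(d²)` operations, all this takes `O((k + 1) d³)`. Orthogonality is what makes an
insertion cheap: the coefficients are quotients of scalar products, and the divisors are non-zero.
-/

section SpanBelow

variable {K ι : Type*} [Semiring K]

/-- The span of the first `n` vectors of a sequence. -/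
def spanBelow (b : ℕ → ι → K) (n : ℕ) : Submodule K (ι → K) :=
  Submodule.span K (b '' Set.Iio n)

theorem mem_spanBelow {b : ℕ → ι → K} {n i : ℕ} (h : i < n) : b i ∈ spanBelow b n :=
  Submodule.subset_span ⟨i, h, rfl⟩

theorem spanBelow_le_iff {b : ℕ → ι → K} {n : ℕ} {W : Submodule K (ι → K)} :
    spanBelow b n ≤ W ↔ ∀ i < n, b i ∈ W := by
  simp [spanBelow, Submodule.span_le, Set.subset_def]

theorem spanBelow_zero (b : ℕ → ι → K) : spanBelow b 0 = ⊥ := by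
  simp [spanBelow]

theorem spanBelow_succ (b : ℕ → ι → K) (n : ℕ) :
    spanBelow b (n + 1) = spanBelow b n ⊔ Submodule.span K {b n} := by
  rw [spanBelow, ← Order.succ_eq_add_one, Order.Iio_succ_eq_insert, Set.image_insert_eq,
    Submodule.span_insert, sup_comm, spanBelow]

theorem spanBelow_congr {b b' : ℕ → ι → K} {n : ℕ} (h : ∀ i < n, b' i = b i) :
    spanBelow b' n = spanBelow b n := by
  rw [spanBelow, spanBelow, Set.image_congr (s := Set.Iio n) h]

end SpanBelow

section OrthogonalSequences

variable {K ι : Type*} [Field K] [Fintype ι]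

/-- The first `n` vectors of `b` are non-zero and pairwise orthogonal. -/
structure IsOrthogonalBelow (b : ℕ → ι → K) (n : ℕ) : Prop where
  ne_zero : ∀ i < n, b i ≠ 0
  pairwise : (Set.Iio n).Pairwise fun i j => b i ⬝ᵥ b j = 0

/-- The Gram–Schmidt residue of `c` after removing its components along `b 0, …, b (n - 1)`, one
after the other. -/
def residue (b : ℕ → ι → K) (c : ι → K) : ℕ → ι → K
  | 0 => c
  | n + 1 => residue b c n - (residue b c n ⬝ᵥ b n / b n ⬝ᵥ b n) • b n

theorem sub_residue_mem_spanBelow (b : ℕ → ι → K) (c : ι → K) (n : ℕ) :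
    c - residue b c n ∈ spanBelow b n := by
  induction n with
  | zero => simp [residue]
  | succ n ih =>
    have hle : spanBelow b n ≤ spanBelow b (n + 1) := by
      rw [spanBelow_succ]; exact le_sup_left
    rw [residue, sub_sub_eq_add_sub, add_sub_right_comm]
    exact add_mem (hle ih) (Submodule.smul_mem _ _ (mem_spanBelow n.lt_succ_self))

theorem spanBelow_sup_span_residue (b : ℕ → ι → K) (c : ι → K) (n : ℕ) :
    spanBelow b n ⊔ Submodule.span K {residue b c n} =
      spanBelow b n ⊔ Submodule.span K {c} := by
  have hsub := sub_residue_mem_spanBelow b c n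
  apply le_antisymm <;> refine sup_le le_sup_left ?_ <;>
    rw [Submodule.span_singleton_le_iff_mem, Submodule.mem_sup]
  · exact ⟨_, neg_mem hsub, c, Submodule.mem_span_singleton_self c, by abel⟩
  · exact ⟨_, hsub, _, Submodule.mem_span_singleton_self _, by abel⟩

namespace IsOrthogonalBelow

variable {b b' : ℕ → ι → K} {n : ℕ}

theorem zero (b : ℕ → ι → K) : IsOrthogonalBelow b 0 where
  ne_zero _ hi := absurd hi (Nat.not_lt_zero _)
  pairwise _ hi := absurd hi (Nat.not_lt_zero _)

theorem congr (h : IsOrthogonalBelow b n) (hb : ∀ i < n, b' i = b i) :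
    IsOrthogonalBelow b' n where
  ne_zero i hi := hb i hi ▸ h.ne_zero i hi
  pairwise i hi j hj hij := by
    simpa only [hb i hi, hb j hj] using h.pairwise hi hj hij

theorem succ (h : IsOrthogonalBelow b n) (hn : b n ≠ 0) (ho : ∀ i < n, b n ⬝ᵥ b i = 0) :
    IsOrthogonalBelow b (n + 1) where
  ne_zero := Nat.forall_lt_succ_right.2 ⟨h.ne_zero, hn⟩
  pairwise := by
    rw [← Order.succ_eq_add_one, Order.Iio_succ_eq_insert]
    exact h.pairwise.insert fun i hi _ => ⟨ho i hi, dotProduct_comm (b i) _ ▸ ho i hi⟩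

variable [LinearOrder K] [IsStrictOrderedRing K]

theorem le_card (h : IsOrthogonalBelow b n) : n ≤ Fintype.card ι := by
  have hli : LinearIndependent K fun i : Fin n => b i :=
    LinearMap.linearIndependent_of_isOrthoᵢ (B := dotProductBilin K K)
      (fun i j hij => h.pairwise i.2 j.2 (Fin.val_ne_of_ne hij))
      fun i hi => h.ne_zero i i.2 (dotProduct_self_eq_zero.1 hi)
  simpa using hli.fintype_card_le_finrank

theorem residue_dotProduct (h : IsOrthogonalBelow b n) (c : ι → K) :
    ∀ i < n, residue b c n ⬝ᵥ b i = 0 := by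
  suffices ∀ j ≤ n, ∀ i < j, residue b c j ⬝ᵥ b i = 0 from this n le_rfl
  intro j hj
  induction j with
  | zero => exact fun i hi => absurd hi i.not_lt_zero
  | succ j ih =>
    have hjj : b j ⬝ᵥ b j ≠ 0 := mt dotProduct_self_eq_zero.1 (h.ne_zero j hj)
    refine Nat.forall_lt_succ_right.2 ⟨fun i hi => ?_, ?_⟩ <;>
      rw [residue, sub_dotProduct, smul_dotProduct, smul_eq_mul]
    · rw [ih (by omega) i hi, h.pairwise hj (hi.trans hj) hi.ne', mul_zero, sub_zero]
    · rw [div_mul_cancel₀ _ hjj, sub_self]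

end IsOrthogonalBelow

/-- The first `n'` vectors of `b'` are an orthogonal system that arises from the first `n` vectors
of `b` by appending vectors such that `c` comes into the span, and nothing more. -/
structure IsInsertion (b : ℕ → ι → K) (n : ℕ) (c : ι → K) (b' : ℕ → ι → K) (n' : ℕ) : Prop where
  isOrthogonalBelow : IsOrthogonalBelow b' n'
  le : n ≤ n'
  eq_of_lt : ∀ i < n, b' i = b i
  spanBelow_eq : spanBelow b' n' = spanBelow b n ⊔ Submodule.span K {c}

namespace IsInsertion

variable {b b' : ℕ → ι → K} {n n' : ℕ} {c : ι → K}

theorem of_residue_eq_zero (h : IsOrthogonalBelow b n) (h0 : residue b c n = 0) :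
    IsInsertion b n c b n where
  isOrthogonalBelow := h
  le := le_rfl
  eq_of_lt _ _ := rfl
  spanBelow_eq := by simp [← spanBelow_sup_span_residue, h0]

theorem of_residue_ne_zero [LinearOrder K] [IsStrictOrderedRing K]
    (h : IsOrthogonalBelow b n) (h0 : residue b c n ≠ 0) (hb : ∀ i < n, b' i = b i)
    (hn : b' n = residue b c n) : IsInsertion b n c b' (n + 1) where
  isOrthogonalBelow := (h.congr hb).succ (hn ▸ h0) fun i hi => by
    rw [hn, hb i hi]
    exact h.residue_dotProduct c i hi
  le := n.le_succ
  eq_of_lt := hb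
  spanBelow_eq := by rw [spanBelow_succ, spanBelow_congr hb, hn, spanBelow_sup_span_residue]

theorem spanBelow_le (h : IsInsertion b n c b' n') : spanBelow b n ≤ spanBelow b' n' :=
  h.spanBelow_eq ▸ le_sup_left

theorem mem (h : IsInsertion b n c b' n') : c ∈ spanBelow b' n' :=
  h.spanBelow_eq ▸ Submodule.mem_sup_right (Submodule.mem_span_singleton_self c)

end IsInsertion

end OrthogonalSequences

namespace Automaton

open Matrix

section ForwardSpace

variable {k N : ℕ} (A : Automaton k N)

/-- The row vector `π M(v₁) ⋯ M(vₜ)`. -/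
def forwardVec (v : List (Fin k)) : Fin N → ℝ :=
  A.init ᵥ* (v.map A.trans).prod

theorem forwardVec_nil : A.forwardVec [] = A.init := by
  simp [forwardVec]

theorem forwardVec_append_singleton (v : List (Fin k)) (a : Fin k) :
    A.forwardVec (v ++ [a]) = A.forwardVec v ᵥ* A.trans a := by
  simp [forwardVec, vecMul_vecMul]

theorem forwardVec_dotProduct_final (v : List (Fin k)) :
    A.forwardVec v ⬝ᵥ A.final = A.wordProb v :=
  (dotProduct_mulVec _ _ _).symm

/-- The forward space of an automaton: the span of the row vectors reached by words. -/
def forwardSpace : Submodule ℝ (Fin N → ℝ) :=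
  Submodule.span ℝ (Set.range A.forwardVec)

theorem init_mem_forwardSpace : A.init ∈ A.forwardSpace :=
  Submodule.subset_span ⟨[], A.forwardVec_nil⟩

theorem vecMul_mem_forwardSpace {w : Fin N → ℝ} (hw : w ∈ A.forwardSpace) (a : Fin k) :
    w ᵥ* A.trans a ∈ A.forwardSpace := by
  suffices A.forwardSpace ≤ A.forwardSpace.comap (A.trans a).vecMulLinear from this hw
  refine Submodule.span_le.2 ?_
  rintro _ ⟨v, rfl⟩
  exact Submodule.subset_span ⟨v ++ [a], A.forwardVec_append_singleton v a⟩

theorem forwardSpace_le {W : Submodule ℝ (Fin N → ℝ)} (hinit : A.init ∈ W)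
    (hstep : ∀ a, ∀ w ∈ W, w ᵥ* A.trans a ∈ W) : A.forwardSpace ≤ W := by
  refine Submodule.span_le.2 ?_
  rintro _ ⟨v, rfl⟩
  induction v using List.reverseRecOn with
  | nil => rwa [forwardVec_nil]
  | append_singleton v a ih =>
    rw [forwardVec_append_singleton]
    exact hstep a _ ih

theorem forall_wordProb_eq_zero_iff :
    (∀ v, A.wordProb v = 0) ↔
      A.forwardSpace ≤ LinearMap.ker ((dotProductBilin ℝ ℝ).flip A.final) := by
  simp [forwardSpace, Submodule.span_le, Set.range_subset_iff, forwardVec_dotProduct_final]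

/-- The first `n` vectors of `b` are an orthogonal basis of a part of the forward space that
contains the initial vector, and the images of the first `p` of them stay in this part. -/
structure IsExplored (b : ℕ → Fin N → ℝ) (n p : ℕ) : Prop where
  isOrthogonalBelow : IsOrthogonalBelow b n
  spanBelow_le : spanBelow b n ≤ A.forwardSpace
  init_mem : A.init ∈ spanBelow b n
  vecMul_mem : ∀ i < p, i < n → ∀ a, b i ᵥ* A.trans a ∈ spanBelow b n

namespace IsExplored

variable {A} {b b' : ℕ → Fin N → ℝ} {n n' p : ℕ}

theorem of_isInsertion_init (h : IsInsertion b 0 A.init b' n) : A.IsExplored b' n 0 where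
  isOrthogonalBelow := h.isOrthogonalBelow
  spanBelow_le := by
    simpa [h.spanBelow_eq, spanBelow_zero] using A.init_mem_forwardSpace
  init_mem := h.mem
  vecMul_mem _ hi := absurd hi (Nat.not_lt_zero _)

theorem insert {c : Fin N → ℝ} (h : A.IsExplored b n p) (hp : p ≤ n) (hc : c ∈ A.forwardSpace)
    (hins : IsInsertion b n c b' n') : A.IsExplored b' n' p where
  isOrthogonalBelow := hins.isOrthogonalBelow
  spanBelow_le := by
    rw [hins.spanBelow_eq]
    exact sup_le h.spanBelow_le ((Submodule.span_singleton_le_iff_mem _ _).2 hc)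
  init_mem := hins.spanBelow_le h.init_mem
  vecMul_mem i hi _ a := by
    rw [hins.eq_of_lt i (hi.trans_le hp)]
    exact hins.spanBelow_le (h.vecMul_mem i hi (hi.trans_le hp) a)

theorem succ (h : A.IsExplored b n p) (hp : p < n → ∀ a, b p ᵥ* A.trans a ∈ spanBelow b n) :
    A.IsExplored b n (p + 1) :=
  { h with vecMul_mem := Nat.forall_lt_succ_right.2 ⟨h.vecMul_mem, hp⟩ }

theorem spanBelow_eq (h : A.IsExplored b n p) (hp : n ≤ p) : spanBelow b n = A.forwardSpace := by
  refine h.spanBelow_le.antisymm (A.forwardSpace_le h.init_mem fun a w hw => ?_)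
  suffices spanBelow b n ≤ (spanBelow b n).comap (A.trans a).vecMulLinear from this hw
  exact spanBelow_le_iff.2 fun i hi => h.vecMul_mem i (hi.trans_le hp) hi a

theorem forall_wordProb_eq_zero_iff (h : A.IsExplored b n p) (hp : n ≤ p) :
    (∀ v, A.wordProb v = 0) ↔ ∀ i < n, b i ⬝ᵥ A.final = 0 := by
  rw [Automaton.forall_wordProb_eq_zero_iff, ← h.spanBelow_eq hp, spanBelow_le_iff]
  simp

end IsExplored

end ForwardSpace

section Difference

variable {k N₁ N₂ : ℕ} (A₁ : Automaton k N₁) (A₂ : Automaton k N₂)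

/-- The difference of two automata: their disjoint union, with the final weights of the second one
negated. -/
def diff : Automaton k (N₁ + N₂) where
  trans a := reindex finSumFinEquiv finSumFinEquiv (fromBlocks (A₁.trans a) 0 0 (A₂.trans a))
  init := Fin.append A₁.init A₂.init
  final := Fin.append A₁.final (-A₂.final)

theorem append_vecMul_diff_trans (u : Fin N₁ → ℝ) (v : Fin N₂ → ℝ) (a : Fin k) :
    Fin.append u v ᵥ* (diff A₁ A₂).trans a =
      Fin.append (u ᵥ* A₁.trans a) (v ᵥ* A₂.trans a) := by
  ext i
  refine Fin.addCases (fun i => ?_) (fun i => ?_) i <;>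
    simp [diff, vecMul, dotProduct, Fin.sum_univ_add]

theorem forwardVec_diff (v : List (Fin k)) :
    (diff A₁ A₂).forwardVec v = Fin.append (A₁.forwardVec v) (A₂.forwardVec v) := by
  induction v using List.reverseRecOn with
  | nil => simp only [forwardVec_nil, diff]
  | append_singleton v a ih =>
    simp only [forwardVec_append_singleton, ih, append_vecMul_diff_trans]

theorem wordProb_diff (v : List (Fin k)) :
    (diff A₁ A₂).wordProb v = A₁.wordProb v - A₂.wordProb v := by
  simp only [← forwardVec_dotProduct_final, forwardVec_diff]
  simp [diff, dotProduct, Fin.sum_univ_add, sub_eq_add_neg]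

theorem equivalent_iff_forall_wordProb_diff :
    A₁.Equivalent A₂ ↔ ∀ v, (diff A₁ A₂).wordProb v = 0 := by
  simp only [Equivalent, wordProb_diff, sub_eq_zero]

end Difference

theorem IsProbabilistic.pos {k N : ℕ} {A : Automaton k N} (hA : A.IsProbabilistic) : 0 < N := by
  have hsum : ∑ s, A.init s = 1 := by rcases hA with hA | hA <;> exact hA.1.2
  refine Nat.pos_of_ne_zero ?_
  rintro rfl
  simp at hsum

end Automaton

namespace RealRAM

/-! ### A program logic for total correctness with cost bounds -/

namespace Program

/-- The registers that a program assigns to. -/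
def regs : Program → Finset ℕ
  | skip => ∅
  | setReg x _ => {x}
  | setCell _ _ _ => ∅
  | seq P Q => P.regs ∪ Q.regs
  | branch _ P Q => P.regs ∪ Q.regs
  | loop _ P => P.regs

/-- The arrays that a program assigns to. -/
def arrs : Program → Finset ℕ
  | skip => ∅
  | setReg _ _ => ∅
  | setCell m _ _ => {m}
  | seq P Q => P.arrs ∪ Q.arrs
  | branch _ P Q => P.arrs ∪ Q.arrs
  | loop _ P => P.arrs

end Program

/-- The registers that an expression reads. -/
def NatExpr.regs : NatExpr → Finset ℕ
  | lit _ => ∅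
  | reg x => {x}
  | add e f => e.regs ∪ f.regs
  | sub e f => e.regs ∪ f.regs
  | mul e f => e.regs ∪ f.regs

theorem NatExpr.eval_congr {σ τ : State} {e : NatExpr} (h : ∀ x ∈ e.regs, τ.reg x = σ.reg x) :
    e.eval τ = e.eval σ := by
  induction e with
  | lit => rfl
  | reg x => exact h x (Finset.mem_singleton_self x)
  | add e f ihe ihf | sub e f ihe ihf | mul e f ihe ihf =>
    simp only [regs, Finset.mem_union] at h
    simp only [eval, ihe fun x hx => h x (.inl hx), ihf fun x hx => h x (.inr hx)]

/-- The states `σ` and `τ` agree on the registers outside `R` and on the arrays outside `M`. -/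
structure AgreeOff (R M : Finset ℕ) (σ τ : State) : Prop where
  reg_eq : ∀ {x}, x ∉ R → τ.reg x = σ.reg x
  arr_eq : ∀ {m}, m ∉ M → τ.arr m = σ.arr m

namespace AgreeOff

variable {R R' M M' : Finset ℕ} {σ τ υ : State}

theorem refl (R M : Finset ℕ) (σ : State) : AgreeOff R M σ σ := ⟨fun _ => rfl, fun _ => rfl⟩

theorem mono (h : AgreeOff R M σ τ) (hR : R ⊆ R') (hM : M ⊆ M') : AgreeOff R' M' σ τ :=
  ⟨fun hx => h.reg_eq (mt (@hR _) hx), fun hm => h.arr_eq (mt (@hM _) hm)⟩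

theorem trans (h : AgreeOff R M σ τ) (h' : AgreeOff R M τ υ) : AgreeOff R M σ υ :=
  ⟨fun hx => (h'.reg_eq hx).trans (h.reg_eq hx), fun hm => (h'.arr_eq hm).trans (h.arr_eq hm)⟩

theorem setReg (σ : State) {x : ℕ} (v : ℕ) (hx : x ∈ R) : AgreeOff R M σ (σ.setReg x v) :=
  ⟨fun hy => Function.update_of_ne (ne_of_mem_of_not_mem hx hy).symm _ _, fun _ => rfl⟩

theorem setCell (σ : State) {m : ℕ} (i : ℕ) (r : ℝ) (hm : m ∈ M) :
    AgreeOff R M σ (σ.setCell m i r) :=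
  ⟨fun _ => rfl, fun hl => Function.update_of_ne (ne_of_mem_of_not_mem hm hl).symm _ _⟩

theorem eval_eq (h : AgreeOff R M σ τ) {e : NatExpr} (he : Disjoint e.regs R) :
    e.eval τ = e.eval σ :=
  NatExpr.eval_congr fun _ hx => h.reg_eq (Finset.disjoint_left.1 he hx)

end AgreeOff

/-- A computation of `P` from `σ` to `τ` can change at most what `P` assigns to. -/
def Program.Frame (P : Program) (σ τ : State) : Prop :=
  AgreeOff P.regs P.arrs σ τ

theorem Exec.frame {P : Program} {σ τ : State} {t : ℕ} (h : Exec P σ τ t) : P.Frame σ τ := by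
  induction h with
  | skip | loop_done => exact .refl _ _ _
  | setReg => exact .setReg _ _ (Finset.mem_singleton_self _)
  | setCell => exact .setCell _ _ _ (Finset.mem_singleton_self _)
  | seq _ _ hP hQ =>
    exact (hP.mono Finset.subset_union_left Finset.subset_union_left).trans
      (hQ.mono Finset.subset_union_right Finset.subset_union_right)
  | branch_true _ _ _ hP => exact hP.mono Finset.subset_union_left Finset.subset_union_left
  | branch_false _ _ _ hQ => exact hQ.mono Finset.subset_union_right Finset.subset_union_right
  | loop_step _ _ _ _ hP hL => exact hP.trans hL

/-- Started in `σ`, the program `P` halts after a computation of cost at most `T` in a state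
that satisfies `Q`. -/
def Runs (P : Program) (σ : State) (T : ℕ) (Q : State → Prop) : Prop :=
  ∃ τ t, Exec P σ τ t ∧ t ≤ T ∧ Q τ

namespace Runs

variable {P P' : Program} {σ : State} {T T' : ℕ} {Q Q' : State → Prop}

theorem mono (h : Runs P σ T Q) (hT : T ≤ T') (hQ : ∀ τ, P.Frame σ τ → Q τ → Q' τ) :
    Runs P σ T' Q' := by
  obtain ⟨τ, t, h, ht, hq⟩ := h
  exact ⟨τ, t, h, ht.trans hT, hQ τ h.frame hq⟩

theorem mono_cost (h : Runs P σ T Q) (hT : T ≤ T') : Runs P σ T' Q :=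
  h.mono hT fun _ _ => id

theorem skip (h : Q σ) : Runs .skip σ 1 Q := ⟨σ, 1, .skip σ, le_rfl, h⟩

theorem setReg {x : ℕ} {e : NatExpr} (h : Q (σ.setReg x (e.eval σ))) :
    Runs (.setReg x e) σ (e.cost + 1) Q :=
  ⟨_, _, .setReg σ x e, le_rfl, h⟩

theorem setCell {m : ℕ} {i : NatExpr} {e : RealExpr} (he : e.Valid σ)
    (h : Q (σ.setCell m (i.eval σ) (e.eval σ))) :
    Runs (.setCell m i e) σ (i.cost + e.cost + 1) Q :=
  ⟨_, _, .setCell σ m i e he, le_rfl, h⟩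

theorem seq (h : Runs P σ T Q') (h' : ∀ τ, P.Frame σ τ → Q' τ → Runs P' τ T' Q) :
    Runs (.seq P P') σ (T + T') Q := by
  obtain ⟨τ, t, h, ht, hq⟩ := h
  obtain ⟨υ, u, h', hu, hq'⟩ := h' τ h.frame hq
  exact ⟨υ, t + u, .seq h h', add_le_add ht hu, hq'⟩

theorem branch {b : Test} (hv : b.Valid σ) (ht : b.Holds σ → Runs P σ T Q)
    (hf : ¬ b.Holds σ → Runs P' σ T Q) : Runs (.branch b P P') σ (b.cost + 1 + T) Q := by
  by_cases hb : b.Holds σ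
  · obtain ⟨τ, t, h, ht, hq⟩ := ht hb
    exact ⟨τ, _, .branch_true hv hb h, by omega, hq⟩
  · obtain ⟨τ, t, h, ht, hq⟩ := hf hb
    exact ⟨τ, _, .branch_false hv hb h, by omega, hq⟩

theorem loop_done {b : Test} (hv : b.Valid σ) (hb : ¬ b.Holds σ) (h : Q σ) :
    Runs (.loop b P) σ (b.cost + 1) Q :=
  ⟨σ, _, .loop_done hv hb, le_rfl, h⟩

theorem loop_step {b : Test} (hv : b.Valid σ) (hb : b.Holds σ) (h : Runs P σ T Q')
    (h' : ∀ τ, P.Frame σ τ → Q' τ → Runs (.loop b P) τ T' Q) :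
    Runs (.loop b P) σ (b.cost + 1 + T + T') Q := by
  obtain ⟨τ, t, h, ht, hq⟩ := h
  obtain ⟨υ, u, h', hu, hq'⟩ := h' τ h.frame hq
  exact ⟨υ, _, .loop_step hv hb h h', by omega, hq'⟩

end Runs

@[simp]
theorem State.setReg_reg_self (σ : State) (x v : ℕ) : (σ.setReg x v).reg x = v :=
  Function.update_self ..

@[simp]
theorem State.setReg_arr (σ : State) (x v : ℕ) : (σ.setReg x v).arr = σ.arr := rfl

@[simp]
theorem State.setCell_arr_self (σ : State) (m i : ℕ) (r : ℝ) :
    (σ.setCell m i r).arr m = Function.update (σ.arr m) i r :=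
  Function.update_self ..

/-- Run `P` with the values `0, 1, …` of register `x`, as long as they are less than the content of
register `y`. -/
def forLoop (x y : ℕ) (P : Program) : Program :=
  .seq (.setReg x (.lit 0))
    (.loop (.natLt (.reg x) (.reg y)) (.seq P (.setReg x (.add (.reg x) (.lit 1)))))

theorem regs_forLoop (x y : ℕ) (P : Program) : (forLoop x y P).regs = insert x P.regs := by
  ext; simp [forLoop, Program.regs]

theorem arrs_forLoop (x y : ℕ) (P : Program) : (forLoop x y P).arrs = P.arrs := by
  simp [forLoop, Program.arrs]

theorem Runs.forLoop {x y : ℕ} {P : Program} {σ : State} {n T : ℕ} {I : ℕ → State → Prop}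
    (hn : σ.reg y = n) (hx : x ∉ P.regs) (hy : y ∉ (forLoop x y P).regs)
    (h0 : I 0 (σ.setReg x 0))
    (hP : ∀ i < n, ∀ τ, (RealRAM.forLoop x y P).Frame σ τ → τ.reg x = i → I i τ →
      Runs P τ T fun υ => I (i + 1) (υ.setReg x (i + 1))) :
    Runs (forLoop x y P) σ ((n + 1) * (T + 8)) (I n) := by
  have hloop : ∀ j i τ, i + j = n → (RealRAM.forLoop x y P).Frame σ τ → τ.reg x = i → I i τ →
      Runs (.loop (.natLt (.reg x) (.reg y)) (.seq P (.setReg x (.add (.reg x) (.lit 1))))) τ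
        (j * (T + 8) + 4) (I n) := by
    intro j
    induction j with
    | zero =>
      rintro i τ hi hτ hxi h
      obtain rfl : i = n := by omega
      refine (Runs.loop_done (by trivial) ?_ h).mono_cost (by simp [Test.cost, NatExpr.cost])
      simp [Test.Holds, NatExpr.eval, hxi, hτ.reg_eq hy, hn]
    | succ j ih =>
      rintro i τ hi hτ hxi h
      have hbody : Runs (.seq P (.setReg x (.add (.reg x) (.lit 1)))) τ (T + 4) fun υ =>
          υ.reg x = i + 1 ∧ I (i + 1) υ :=
        (hP i (by omega) τ hτ hxi h).seq fun υ hυ hI => Runs.setReg (by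
          simpa [NatExpr.eval, hυ.reg_eq hx, hxi] using hI)
      refine (Runs.loop_step (by trivial) ?_ hbody fun υ hυ hI => ih (i + 1) υ (by omega)
        (hτ.trans (hυ.mono ?_ ?_)) hI.1 hI.2).mono_cost ?_
      · simp only [Test.Holds, NatExpr.eval, hxi, hτ.reg_eq hy, hn]; omega
      · exact Finset.subset_union_right
      · exact Finset.subset_union_right
      · simp only [Test.cost, NatExpr.cost]; linarith
  refine (Runs.setReg (Q := fun τ => τ = σ.setReg x 0) rfl).seq (fun τ hτ hI => ?_)
    |>.mono_cost (T := 2 + (n * (T + 8) + 4)) (by linarith)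
  subst hI
  exact hloop n 0 _ (by omega) (hτ.mono Finset.subset_union_left Finset.subset_union_left)
    (by simp) h0

/-! ### Blocks of cells -/

/-- The vector that an array stores in the `n` cells from address `o` on. -/
def slice (n : ℕ) (B : ℕ → ℝ) (o : ℕ) : Fin n → ℝ :=
  fun s => B (o + s)

/-- The vectors of length `d` that an array stores one after the other. -/
def rows (d : ℕ) (B : ℕ → ℝ) (i : ℕ) : Fin d → ℝ :=
  slice d B (i * d)

/-- The array `B'` stores the vector `g` from address `o` on and agrees with `B` below `o`. -/
structure Fills {n : ℕ} (B : ℕ → ℝ) (o : ℕ) (g : Fin n → ℝ) (B' : ℕ → ℝ) : Prop where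
  eq_of_lt : ∀ j < o, B' j = B j
  slice_eq : slice n B' o = g

theorem slice_add (m n : ℕ) (B : ℕ → ℝ) (o : ℕ) :
    slice (m + n) B o = Fin.append (slice m B o) (slice n B (o + m)) := by
  ext i
  refine Fin.addCases (fun s => ?_) (fun s => ?_) i <;> simp [slice, add_assoc]

theorem Fills.slice_eq_append {m n : ℕ} {B B' B'' : ℕ → ℝ} {f : Fin m → ℝ} {g : Fin n → ℝ}
    (hf : Fills B 0 f B') (hg : Fills B' m g B'') : slice (m + n) B'' 0 = Fin.append f g := by
  have hlow : slice m B'' 0 = slice m B' 0 := funext fun s => hg.eq_of_lt _ (by omega)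
  rw [slice_add, zero_add, hlow, hf.slice_eq, hg.slice_eq]

theorem Fills.rows_eq {d i j : ℕ} {B B' : ℕ → ℝ} {g : Fin d → ℝ} (h : Fills B (i * d) g B')
    (hj : j < i) : rows d B' j = rows d B j :=
  funext fun s => h.eq_of_lt _ (by nlinarith [s.2])

theorem Runs.fill {x y m : ℕ} {P : Program} {σ : State} {n o T : ℕ} {g : Fin n → ℝ}
    (hn : σ.reg y = n) (hx : x ∉ P.regs) (hy : y ∉ (RealRAM.forLoop x y P).regs)
    (hP : ∀ (i : Fin n) τ, (RealRAM.forLoop x y P).Frame σ τ → τ.reg x = i →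
      τ.arr m (o + i) = σ.arr m (o + i) →
      Runs P τ T fun υ => υ.arr m = Function.update (τ.arr m) (o + i) (g i)) :
    Runs (RealRAM.forLoop x y P) σ ((n + 1) * (T + 8)) fun τ =>
      Fills (σ.arr m) o g (τ.arr m) := by
  refine (Runs.forLoop (I := fun i τ => (∀ j, (j < o ∨ o + i ≤ j) → τ.arr m j = σ.arr m j) ∧
    ∀ s : Fin n, s < i → τ.arr m (o + s) = g s) hn hx hy (by simp)
    fun i hi τ hτ hxi ⟨hold, hnew⟩ => ?_).mono le_rfl fun τ _ ⟨hold, hnew⟩ =>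
      ⟨fun j hj => hold j (.inl hj), funext fun s => hnew s s.2⟩
  refine (hP ⟨i, hi⟩ τ hτ hxi (hold _ (.inr le_rfl))).mono le_rfl fun υ _ hυ => ?_
  simp only [State.setReg_arr, hυ]
  refine ⟨fun j hj => ?_, fun s hs => ?_⟩
  · rw [Function.update_of_ne (by omega), hold j (by omega)]
  · rcases Nat.lt_succ_iff_lt_or_eq.1 hs with hs | rfl
    · rw [Function.update_of_ne (by omega), hnew s hs]
    · exact Function.update_self ..

/-- Assign `r` to the cells `o + x` of array `m`, where register `x` runs through the numbers less
than the content of register `y`. -/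
def assignBlock (m : ℕ) (o : NatExpr) (x y : ℕ) (r : RealExpr) : Program :=
  forLoop x y (.setCell m (.add o (.reg x)) r)

theorem regs_assignBlock (m : ℕ) (o : NatExpr) (x y : ℕ) (r : RealExpr) :
    (assignBlock m o x y r).regs = {x} := by
  simp [assignBlock, regs_forLoop, Program.regs]

theorem arrs_assignBlock (m : ℕ) (o : NatExpr) (x y : ℕ) (r : RealExpr) :
    (assignBlock m o x y r).arrs = {m} := by
  simp [assignBlock, arrs_forLoop, Program.arrs]

theorem Runs.assignBlock {m x y : ℕ} {o : NatExpr} {r : RealExpr} {σ : State} {n : ℕ}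
    {g : Fin n → ℝ} (hn : σ.reg y = n) (hy : y ≠ x) (ho : x ∉ o.regs)
    (hr : ∀ (i : Fin n) τ, AgreeOff {x} {m} σ τ → τ.reg x = i →
      τ.arr m (o.eval σ + i) = σ.arr m (o.eval σ + i) → r.Valid τ ∧ r.eval τ = g i) :
    Runs (assignBlock m o x y r) σ ((n + 1) * (o.cost + r.cost + 11)) fun τ =>
      Fills (σ.arr m) (o.eval σ) g (τ.arr m) := by
  refine Runs.fill (T := o.cost + r.cost + 3) hn (by simp [Program.regs])
    (by simpa [regs_forLoop, Program.regs]) fun i τ hτ hxi hm => ?_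
  replace hτ : AgreeOff {x} {m} σ τ :=
    hτ.mono (regs_assignBlock m o x y r).subset (arrs_assignBlock m o x y r).subset
  obtain ⟨hv, hg⟩ := hr i τ hτ hxi hm
  refine (Runs.setCell hv ?_).mono_cost (by simp only [NatExpr.cost]; omega)
  simp [NatExpr.eval, hxi, hτ.eval_eq (Finset.disjoint_singleton_right.2 ho), hg]

/-- Assign to cell `c` of array `m` the sum of the values of `r`, where register `x` runs through
the numbers less than the content of register `y`. -/
def sumInto (m : ℕ) (c : NatExpr) (x y : ℕ) (r : RealExpr) : Program :=
  .seq (.setCell m c (.lit 0)) (forLoop x y (.setCell m c (.add (.cell m c) r)))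

theorem regs_sumInto (m : ℕ) (c : NatExpr) (x y : ℕ) (r : RealExpr) :
    (sumInto m c x y r).regs = {x} := by
  simp [sumInto, regs_forLoop, Program.regs]

theorem arrs_sumInto (m : ℕ) (c : NatExpr) (x y : ℕ) (r : RealExpr) :
    (sumInto m c x y r).arrs = {m} := by
  simp [sumInto, arrs_forLoop, Program.arrs]

theorem Runs.sumInto {m x y : ℕ} {c : NatExpr} {r : RealExpr} {σ : State} {n : ℕ}
    {g : Fin n → ℝ} (hn : σ.reg y = n) (hy : y ≠ x) (hc : x ∉ c.regs)
    (hr : ∀ (i : Fin n) τ, AgreeOff {x} {m} σ τ → τ.reg x = i → r.Valid τ ∧ r.eval τ = g i) :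
    Runs (sumInto m c x y r) σ ((n + 1) * (3 * c.cost + r.cost + 13)) fun τ =>
      τ.arr m = Function.update (σ.arr m) (c.eval σ) (∑ i, g i) := by
  set s : ℕ → ℝ := fun i => ∑ j ∈ Finset.range i, if h : j < n then g ⟨j, h⟩ else 0 with hs
  have hsum : s n = ∑ i, g i := by simp [hs, Finset.sum_range]
  refine (Runs.setCell (Q := fun τ => τ.arr m = Function.update (σ.arr m) (c.eval σ) 0)
    (by trivial) (by simp [RealExpr.eval])).seq (T' := (n + 1) * (2 * c.cost + r.cost + 11))
    (fun τ hτ hm => (Runs.forLoop (T := 2 * c.cost + r.cost + 3)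
      (I := fun i τ => τ.arr m = Function.update (σ.arr m) (c.eval σ) (s i))
      ((hτ.reg_eq (by simp [Program.regs])).trans hn) (by simp [Program.regs])
      (by simpa [regs_forLoop, Program.regs]) (by simpa [hs]) fun i hi υ hυ hxi hI => ?_).mono
      le_rfl fun υ _ hυ => hsum ▸ hυ) |>.mono_cost ?_
  · have hσυ : AgreeOff {x} {m} σ υ := (hτ.mono (by simp [Program.regs])
      (by simp [Program.arrs])).trans (hυ.mono (by simp [regs_forLoop, Program.regs])
      (by simp [arrs_forLoop, Program.arrs]))
    obtain ⟨hv, hg⟩ := hr ⟨i, hi⟩ υ hσυ hxi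
    refine (Runs.setCell (e := .add (.cell m c) r) ⟨trivial, hv⟩ ?_).mono_cost
      (by simp only [RealExpr.cost]; omega)
    simp [RealExpr.eval, hσυ.eval_eq (Finset.disjoint_singleton_right.2 hc), hg, hI, hs,
      Finset.sum_range_succ, hi]
  · simp only [RealExpr.cost]; nlinarith [Nat.zero_le (n * c.cost)]

/-! ### The equivalence test -/

/- Registers 0 to 2 and arrays 0 to 5 are those of `input`. Register 0 can serve both for the size
of the alphabet and for the answer, as the former is no longer needed when the latter is given. -/

namespace Reg

abbrev alphabet : ℕ := 0
abbrev answer : ℕ := 0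
abbrev states₁ : ℕ := 1
abbrev states₂ : ℕ := 2

/-- The number of states of the difference automaton. -/
abbrev dim : ℕ := 3

/-- The number of vectors in the basis. -/
abbrev count : ℕ := 4

/-- The number of the basis vector whose images are being inserted. -/
abbrev pivot : ℕ := 5

abbrev letter : ℕ := 6
abbrev row : ℕ := 7
abbrev outer : ℕ := 8
abbrev inner : ℕ := 9

end Reg

namespace Arr

abbrev init₁ : ℕ := 0
abbrev final₁ : ℕ := 1
abbrev trans₁ : ℕ := 2
abbrev init₂ : ℕ := 3
abbrev final₂ : ℕ := 4
abbrev trans₂ : ℕ := 5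

/-- The vectors of the basis, one after the other. -/
abbrev basis : ℕ := 6

/-- The vector that is to be inserted into the basis. -/
abbrev candidate : ℕ := 7

/-- The final weights of the difference automaton. -/
abbrev final : ℕ := 8

abbrev scratch : ℕ := 9

end Arr

/-- The address of a row of the basis; the number of the row is in register `x`. -/
def rowAddr (x : ℕ) : NatExpr :=
  .mul (.reg x) (.reg Reg.dim)

/-- Store the scalar product of the vectors at `l[o]` and `m[o']` in `scratch[c]`. -/
def dotInto (c l : ℕ) (o : NatExpr) (m : ℕ) (o' : NatExpr) : Program :=
  sumInto Arr.scratch (.lit c) Reg.inner Reg.dim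
    (.mul (.cell l (.add o (.reg Reg.inner))) (.cell m (.add o' (.reg Reg.inner))))

theorem Runs.dotInto {c l m d : ℕ} {o o' : NatExpr} {σ : State} (hd : σ.reg Reg.dim = d)
    (hl : l ≠ Arr.scratch) (hm : m ≠ Arr.scratch) (ho : Reg.inner ∉ o.regs)
    (ho' : Reg.inner ∉ o'.regs) :
    Runs (dotInto c l o m o') σ ((d + 1) * (o.cost + o'.cost + 23)) fun τ =>
      τ.arr Arr.scratch = Function.update (σ.arr Arr.scratch) c
        (slice d (σ.arr l) (o.eval σ) ⬝ᵥ slice d (σ.arr m) (o'.eval σ)) := by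
  refine (Runs.sumInto hd (by decide) (by simp [NatExpr.regs]) fun i τ hτ hi =>
    ⟨by simp [RealExpr.Valid], ?_⟩).mono_cost ?_
  · simp [RealExpr.eval, NatExpr.eval, slice, hi, hτ.arr_eq (Finset.notMem_singleton.2 hl),
      hτ.arr_eq (Finset.notMem_singleton.2 hm), hτ.eval_eq (Finset.disjoint_singleton_right.2 ho),
      hτ.eval_eq (Finset.disjoint_singleton_right.2 ho')]
  · exact Nat.mul_le_mul_left _ (by simp only [RealExpr.cost, NatExpr.cost]; omega)

/-- Subtract from the candidate its component along a row of the basis. -/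
def projectStep : Program :=
  .seq (dotInto 0 Arr.candidate (.lit 0) Arr.basis (rowAddr Reg.row))
    (.seq (dotInto 1 Arr.basis (rowAddr Reg.row) Arr.basis (rowAddr Reg.row))
      (assignBlock Arr.candidate (.lit 0) Reg.outer Reg.dim
        (.sub (.cell Arr.candidate (.reg Reg.outer))
          (.mul (.div (.cell Arr.scratch (.lit 0)) (.cell Arr.scratch (.lit 1)))
            (.cell Arr.basis (.add (rowAddr Reg.row) (.reg Reg.outer)))))))

theorem Runs.projectStep {σ : State} {d i : ℕ} (hd : σ.reg Reg.dim = d) (hi : σ.reg Reg.row = i)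
    {b c : Fin d → ℝ} (hb : rows d (σ.arr Arr.basis) i = b)
    (hc : slice d (σ.arr Arr.candidate) 0 = c) (hbb : b ⬝ᵥ b ≠ 0) :
    Runs projectStep σ (100 * (d + 1)) fun τ =>
      slice d (τ.arr Arr.candidate) 0 = c - (c ⬝ᵥ b / b ⬝ᵥ b) • b := by
  have hrow : (rowAddr Reg.row).eval σ = i * d := by simp [rowAddr, NatExpr.eval, hd, hi]
  refine ((Runs.dotInto hd (by decide) (by decide) (by decide) (by decide)).seq
    fun τ hτ hτs => (Runs.dotInto (d := d) ?_ (by decide) (by decide) (by decide)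
      (by decide)).seq fun υ hυ hυs => (Runs.assignBlock (n := d)
        (g := c - (c ⬝ᵥ b / b ⬝ᵥ b) • b) ?_ (by decide) (by decide) fun s ρ hρ hs hcs => ?_).mono
        le_rfl fun ρ _ h => h.slice_eq).mono_cost ?_
  · exact (hτ.reg_eq (by decide)).trans hd
  · exact (hυ.reg_eq (by decide)).trans ((hτ.reg_eq (by decide)).trans hd)
  · have hσυ : AgreeOff {Reg.inner} {Arr.scratch} σ υ := hτ.trans hυ
    have hσρ : AgreeOff {Reg.inner, Reg.outer} {Arr.scratch, Arr.candidate} σ ρ :=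
      (hσυ.mono (by decide) (by decide)).trans (hρ.mono (by decide) (by decide))
    have hscr : ρ.arr Arr.scratch 0 = c ⬝ᵥ b ∧ ρ.arr Arr.scratch 1 = b ⬝ᵥ b := by
      rw [hρ.arr_eq (by decide)]
      simp [hυs, hτs, ← hb, ← hc, rows, hrow, NatExpr.eval, hτ.arr_eq (m := Arr.basis) (by decide),
        hτ.eval_eq (e := rowAddr Reg.row) (by decide)]
    have hbs : ρ.arr Arr.basis (i * d + s) = b s := by
      rw [hσρ.arr_eq (by decide)]; exact congrFun hb s
    replace hcs : ρ.arr Arr.candidate s = c s := by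
      simpa [NatExpr.eval, hσυ.arr_eq (m := Arr.candidate) (by decide), ← hc, slice] using hcs
    constructor
    · simp [RealExpr.Valid, RealExpr.eval, NatExpr.eval, hscr, hbb]
    · simp [RealExpr.eval, NatExpr.eval, hs, hscr, hbs, hcs,
        hσρ.eval_eq (e := rowAddr Reg.row) (by decide), hrow]
  · simp only [rowAddr, NatExpr.cost, RealExpr.cost]; linarith

/-- Replace the candidate by its residue with respect to the basis. -/
def orthogonalize : Program :=
  forLoop Reg.row Reg.count projectStep

theorem Runs.orthogonalize {σ : State} {d n : ℕ} (hd : σ.reg Reg.dim = d)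
    (hn : σ.reg Reg.count = n) (hb : IsOrthogonalBelow (rows d (σ.arr Arr.basis)) n) :
    Runs orthogonalize σ (108 * (d + 1) ^ 2) fun τ => slice d (τ.arr Arr.candidate) 0 =
      residue (rows d (σ.arr Arr.basis)) (slice d (σ.arr Arr.candidate) 0) n := by
  refine (Runs.forLoop (I := fun i τ => slice d (τ.arr Arr.candidate) 0 =
    residue (rows d (σ.arr Arr.basis)) (slice d (σ.arr Arr.candidate) 0) i)
    hn (by decide) (by decide) (by simp [residue]) fun i hi τ hτ hiτ hI => ?_).mono_cost
    (T := (n + 1) * (100 * (d + 1) + 8)) ?_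
  · rw [residue, ← hI]
    refine Runs.projectStep ((hτ.reg_eq (by decide)).trans hd) hiτ ?_ rfl
      (mt dotProduct_self_eq_zero.1 (hb.ne_zero i hi))
    rw [hτ.arr_eq (by decide)]
  · have := hb.le_card
    rw [Fintype.card_fin] at this
    nlinarith

/-- Append the candidate to the basis. -/
def appendCandidate : Program :=
  .seq (assignBlock Arr.basis (rowAddr Reg.count) Reg.outer Reg.dim
      (.cell Arr.candidate (.reg Reg.outer)))
    (.setReg Reg.count (.add (.reg Reg.count) (.lit 1)))

theorem Runs.appendCandidate {σ : State} {d n : ℕ} (hd : σ.reg Reg.dim = d)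
    (hn : σ.reg Reg.count = n) :
    Runs appendCandidate σ (21 * (d + 1)) fun τ => τ.reg Reg.count = n + 1 ∧
      Fills (σ.arr Arr.basis) (n * d) (slice d (σ.arr Arr.candidate) 0) (τ.arr Arr.basis) := by
  have hrow : (rowAddr Reg.count).eval σ = n * d := by simp [rowAddr, NatExpr.eval, hd, hn]
  refine ((Runs.assignBlock (g := slice d (σ.arr Arr.candidate) 0) hd (by decide) (by decide)
    fun s τ hτ hs _ => ⟨by simp [RealExpr.Valid], ?value⟩).seq fun τ hτ h =>
      Runs.setReg ⟨?count, ?fills⟩) |>.mono_cost ?cost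
  case value =>
    simp [RealExpr.eval, NatExpr.eval, hs, slice, hτ.arr_eq (m := Arr.candidate) (by decide)]
  case count =>
    simpa [NatExpr.eval] using (hτ.reg_eq (by decide)).trans hn
  case fills => rwa [← hrow]
  case cost =>
    simp only [rowAddr, NatExpr.cost, RealExpr.cost]; linarith

/-- Append to the basis the residue of the candidate, unless it vanishes. -/
def insertCandidate : Program :=
  .seq orthogonalize
    (.seq (dotInto 0 Arr.candidate (.lit 0) Arr.candidate (.lit 0))
      (.branch (.realEq (.cell Arr.scratch (.lit 0)) (.lit 0)) .skip appendCandidate))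

theorem Runs.insertCandidate {σ : State} {d n : ℕ} {c : Fin d → ℝ} (hd : σ.reg Reg.dim = d)
    (hn : σ.reg Reg.count = n) (hb : IsOrthogonalBelow (rows d (σ.arr Arr.basis)) n)
    (hc : slice d (σ.arr Arr.candidate) 0 = c) :
    Runs insertCandidate σ (160 * (d + 1) ^ 2) fun τ =>
      IsInsertion (rows d (σ.arr Arr.basis)) n c (rows d (τ.arr Arr.basis)) (τ.reg Reg.count) := by
  refine ((Runs.orthogonalize hd hn hb).seq fun τ hτ hcτ =>
    (Runs.dotInto (d := d) ((hτ.reg_eq (by decide)).trans hd) (by decide) (by decide) (by decide)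
      (by decide)).seq (T' := 6 + 21 * (d + 1)) fun υ hυ h => ?_).mono_cost
      (by simp only [NatExpr.cost]; linarith [Nat.le_self_pow two_ne_zero (d + 1)])
  have hσυ : AgreeOff {Reg.row, Reg.outer, Reg.inner} {Arr.scratch, Arr.candidate} σ υ :=
    (hτ.mono (by decide) (by decide)).trans (hυ.mono (by decide) (by decide))
  have hnυ : υ.reg Reg.count = n := (hσυ.reg_eq (by decide)).trans hn
  have hbυ : υ.arr Arr.basis = σ.arr Arr.basis := hσυ.arr_eq (by decide)
  replace hcυ : slice d (υ.arr Arr.candidate) 0 = residue (rows d (σ.arr Arr.basis)) c n := by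
    rw [hυ.arr_eq (by decide), hcτ, hc]
  have htest : (Test.realEq (.cell Arr.scratch (.lit 0)) (.lit 0)).Holds υ ↔
      residue (rows d (σ.arr Arr.basis)) c n = 0 := by
    rw [← dotProduct_self_eq_zero, ← hc, ← hcτ]
    simp [Test.Holds, RealExpr.eval, NatExpr.eval, h]
  refine Runs.mono_cost (Runs.branch (by simp [Test.Valid, RealExpr.Valid])
    (fun h0 => (Runs.skip ?_).mono_cost (by linarith)) fun h0 =>
      (Runs.appendCandidate ((hσυ.reg_eq (by decide)).trans hd) hnυ).mono le_rfl fun ρ _ hρ => ?_)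
    (by simp only [Test.cost, RealExpr.cost, NatExpr.cost]; linarith)
  · rw [hnυ, hbυ]
    exact .of_residue_eq_zero hb (htest.1 h0)
  · rw [hbυ, hcυ] at hρ
    rw [hρ.1]
    exact .of_residue_ne_zero hb (mt htest.2 h0) (fun i hi => hρ.2.rows_eq hi) hρ.2.slice_eq

open scoped Matrix

/-- Store at `candidate[o]` the product of the vector at address `o` of a row of the basis with a
transition matrix of an automaton, whose number of states is in register `y` and whose matrices are
in array `m`. -/
def mulBlock (o : NatExpr) (y m : ℕ) : Program :=
  forLoop Reg.outer y (sumInto Arr.candidate (.add o (.reg Reg.outer)) Reg.inner y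
    (.mul (.cell Arr.basis (.add (.add (rowAddr Reg.pivot) o) (.reg Reg.inner)))
      (.cell m (.add (.mul (.add (.mul (.reg Reg.letter) (.reg y)) (.reg Reg.inner)) (.reg y))
        (.reg Reg.outer)))))

theorem Runs.mulBlock {k N y m : ℕ} {M : Fin k → Matrix (Fin N) (Fin N) ℝ} {a : Fin k}
    {o : NatExpr} {σ : State} (hN : σ.reg y = N) (ha : σ.reg Reg.letter = a)
    (hM : σ.arr m = transArray M) (hy : y ∉ ({Reg.outer, Reg.inner} : Finset ℕ))
    (ho : Disjoint o.regs {Reg.outer, Reg.inner}) (hm : m ≠ Arr.candidate) :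
    Runs (mulBlock o y m) σ ((4 * o.cost + 45) * (N + 1) ^ 2) fun τ =>
      Fills (σ.arr Arr.candidate) (o.eval σ)
        (slice N (σ.arr Arr.basis) ((rowAddr Reg.pivot).eval σ + o.eval σ) ᵥ* M a)
        (τ.arr Arr.candidate) := by
  simp only [Finset.mem_insert, Finset.mem_singleton, not_or] at hy
  refine (Runs.fill (T := (N + 1) * (4 * o.cost + 37)) hN (by simp [regs_sumInto])
    (by simp [regs_forLoop, regs_sumInto, hy]) fun t τ hτ ht _ => ?_).mono_cost (by nlinarith)
  replace hτ : AgreeOff {Reg.outer, Reg.inner} {Arr.candidate} σ τ :=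
    hτ.mono (by simp [regs_forLoop, regs_sumInto]) (by simp [arrs_forLoop, arrs_sumInto])
  have hoτ : o.eval τ = o.eval σ := hτ.eval_eq ho
  refine (Runs.sumInto (n := N) (g := fun s => slice N (σ.arr Arr.basis)
      ((rowAddr Reg.pivot).eval σ + o.eval σ) s * M a s t) ?_ hy.2 ?_ fun s υ hυ hs => ?_).mono
      ?_ fun υ _ hυ => ?_
  · exact (hτ.reg_eq (by simp [hy])).trans hN
  · simpa [NatExpr.regs] using Finset.disjoint_right.1 ho (by simp)
  · have htυ : υ.reg Reg.outer = t := (hυ.reg_eq (by decide)).trans ht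
    replace hυ : AgreeOff {Reg.outer, Reg.inner} {Arr.candidate} σ υ :=
      hτ.trans (hυ.mono (by simp) (by simp))
    have hyυ : υ.reg y = N := (hυ.reg_eq (by simp [hy])).trans hN
    have haυ : υ.reg Reg.letter = a := (hυ.reg_eq (by decide)).trans ha
    have hMυ : υ.arr m ((a * N + s) * N + t) = M a s t := by
      rw [hυ.arr_eq (by simpa), hM, transArray_apply]
    refine ⟨by simp [RealExpr.Valid], ?_⟩
    simp [RealExpr.eval, NatExpr.eval, slice, hs, htυ, hyυ, haυ, hMυ, hυ.eval_eq ho,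
      hυ.eval_eq (e := rowAddr Reg.pivot) (by decide), hυ.arr_eq (m := Arr.basis) (by decide)]
  · exact Nat.mul_le_mul_left _ (by simp only [NatExpr.cost, RealExpr.cost, rowAddr]; omega)
  · simpa [NatExpr.eval, ht, hoτ, Matrix.vecMul, dotProduct] using hυ

/-- Replace the candidate by the image of a row of the basis under a transition matrix of the
difference automaton. -/
def image : Program :=
  .seq (mulBlock (.lit 0) Reg.states₁ Arr.trans₁)
    (mulBlock (.reg Reg.states₁) Reg.states₂ Arr.trans₂)

/-- The data on the automata that remain fixed until the answer is given. -/
structure Loaded {k N₁ N₂ : ℕ} (A₁ : Automaton k N₁) (A₂ : Automaton k N₂) (σ : State) :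
    Prop where
  alphabet_eq : σ.reg Reg.alphabet = k
  states₁_eq : σ.reg Reg.states₁ = N₁
  states₂_eq : σ.reg Reg.states₂ = N₂
  dim_eq : σ.reg Reg.dim = N₁ + N₂
  trans₁_eq : σ.arr Arr.trans₁ = transArray A₁.trans
  trans₂_eq : σ.arr Arr.trans₂ = transArray A₂.trans
  final_eq : slice (N₁ + N₂) (σ.arr Arr.final) 0 = (A₁.diff A₂).final

variable {k N₁ N₂ : ℕ} {A₁ : Automaton k N₁} {A₂ : Automaton k N₂}

theorem Loaded.of_agreeOff {R M : Finset ℕ} {σ τ : State} (h : Loaded A₁ A₂ σ)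
    (hστ : AgreeOff R M σ τ)
    (hR : Disjoint R {Reg.alphabet, Reg.states₁, Reg.states₂, Reg.dim})
    (hM : Disjoint M {Arr.trans₁, Arr.trans₂, Arr.final}) : Loaded A₁ A₂ τ where
  alphabet_eq := (hστ.reg_eq (Finset.disjoint_right.1 hR (by simp))).trans h.alphabet_eq
  states₁_eq := (hστ.reg_eq (Finset.disjoint_right.1 hR (by simp))).trans h.states₁_eq
  states₂_eq := (hστ.reg_eq (Finset.disjoint_right.1 hR (by simp))).trans h.states₂_eq
  dim_eq := (hστ.reg_eq (Finset.disjoint_right.1 hR (by simp))).trans h.dim_eq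
  trans₁_eq := (hστ.arr_eq (Finset.disjoint_right.1 hM (by simp))).trans h.trans₁_eq
  trans₂_eq := (hστ.arr_eq (Finset.disjoint_right.1 hM (by simp))).trans h.trans₂_eq
  final_eq := by rw [hστ.arr_eq (Finset.disjoint_right.1 hM (by simp)), h.final_eq]

theorem Runs.image {σ : State} {p : ℕ} {a : Fin k} (h : Loaded A₁ A₂ σ)
    (hp : σ.reg Reg.pivot = p) (ha : σ.reg Reg.letter = a) :
    Runs image σ (98 * (N₁ + N₂ + 1) ^ 2) fun τ =>
      slice (N₁ + N₂) (τ.arr Arr.candidate) 0 =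
        rows (N₁ + N₂) (σ.arr Arr.basis) p ᵥ* (A₁.diff A₂).trans a := by
  have hrow : (rowAddr Reg.pivot).eval σ = p * (N₁ + N₂) := by
    simp [rowAddr, NatExpr.eval, hp, h.dim_eq]
  refine ((Runs.mulBlock h.states₁_eq ha h.trans₁_eq (by decide) (by decide) (by decide)).seq
    fun τ hτ hτc => (Runs.mulBlock (M := A₂.trans) (a := a)
      ((hτ.reg_eq (by decide)).trans h.states₂_eq) ((hτ.reg_eq (by decide)).trans ha)
      ((hτ.arr_eq (by decide)).trans h.trans₂_eq)
      (by decide) (by decide) (by decide)).mono le_rfl fun υ _ hυc => ?_).mono_cost ?_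
  · have hτs : (NatExpr.reg Reg.states₁).eval τ = N₁ := (hτ.reg_eq (by decide)).trans h.states₁_eq
    rw [hτ.arr_eq (m := Arr.basis) (by decide), hτ.eval_eq (e := rowAddr Reg.pivot) (by decide),
      hrow, hτs] at hυc
    rw [hrow] at hτc
    rw [hτc.slice_eq_append hυc, rows, slice_add, Automaton.append_vecMul_diff_trans]
    rfl
  · simp only [NatExpr.cost]; nlinarith

/-- Store in array `m` the values of `r₁`, followed by those of `r₂`, where register `outer` runs
through the states of the first and of the second automaton. -/
def concat (m : ℕ) (r₁ r₂ : RealExpr) : Program :=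
  .seq (assignBlock m (.lit 0) Reg.outer Reg.states₁ r₁)
    (assignBlock m (.reg Reg.states₁) Reg.outer Reg.states₂ r₂)

theorem Runs.concat {m : ℕ} {r₁ r₂ : RealExpr} {σ : State} {g₁ : Fin N₁ → ℝ} {g₂ : Fin N₂ → ℝ}
    (hN₁ : σ.reg Reg.states₁ = N₁) (hN₂ : σ.reg Reg.states₂ = N₂)
    (hr₁ : ∀ (i : Fin N₁) τ, AgreeOff {Reg.outer} {m} σ τ → τ.reg Reg.outer = i →
      r₁.Valid τ ∧ r₁.eval τ = g₁ i)
    (hr₂ : ∀ (i : Fin N₂) τ, AgreeOff {Reg.outer} {m} σ τ → τ.reg Reg.outer = i →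
      r₂.Valid τ ∧ r₂.eval τ = g₂ i) :
    Runs (concat m r₁ r₂) σ ((N₁ + N₂ + 1) * (r₁.cost + r₂.cost + 24)) fun τ =>
      slice (N₁ + N₂) (τ.arr m) 0 = Fin.append g₁ g₂ := by
  refine ((Runs.assignBlock hN₁ (by decide) (by decide) fun i τ hτ hi _ => hr₁ i τ hτ hi).seq
    (T' := (N₂ + 1) * (r₂.cost + 12)) fun τ hτ hg₁ => ?second).mono_cost ?cost
  case second =>
    replace hτ : AgreeOff {Reg.outer} {m} σ τ :=
      hτ.mono (regs_assignBlock ..).subset (arrs_assignBlock ..).subset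
    have hN₁τ : (NatExpr.reg Reg.states₁).eval τ = N₁ := (hτ.reg_eq (by decide)).trans hN₁
    refine (Runs.assignBlock ((hτ.reg_eq (by decide)).trans hN₂) (by decide) (by decide)
      fun i υ hυ hi _ => hr₂ i υ (hτ.trans hυ) hi).mono
        (Nat.mul_le_mul_left _ (by simp only [NatExpr.cost]; omega)) fun υ _ hg₂ => ?_
    exact hg₁.slice_eq_append (hN₁τ ▸ hg₂)
  case cost => simp only [NatExpr.cost]; nlinarith

/-- The rows of the basis solve the exploration task for the difference automaton, where the rows
before row `p` have been processed. -/
def Explored (A₁ : Automaton k N₁) (A₂ : Automaton k N₂) (p : ℕ) (σ : State) : Prop :=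
  (A₁.diff A₂).IsExplored (rows (N₁ + N₂) (σ.arr Arr.basis)) (σ.reg Reg.count) p

/-- Compute the dimension, the final weights and the initial vector of the difference automaton. -/
def loadDiff : Program :=
  .seq (.setReg Reg.dim (.add (.reg Reg.states₁) (.reg Reg.states₂)))
    (.seq (concat Arr.final (.cell Arr.final₁ (.reg Reg.outer))
        (.mul (.lit (-1)) (.cell Arr.final₂ (.reg Reg.outer))))
      (concat Arr.candidate (.cell Arr.init₁ (.reg Reg.outer)) (.cell Arr.init₂ (.reg Reg.outer))))

theorem RealExpr.eval_cell_reg {m x n : ℕ} {f : Fin n → ℝ} {i : Fin n} {σ : State}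
    (hm : σ.arr m = vecArray f) (hx : σ.reg x = i) : (cell m (.reg x)).eval σ = f i := by
  simp [eval, NatExpr.eval, hm, hx, vecArray]

theorem Runs.loadDiff (A₁ : Automaton k N₁) (A₂ : Automaton k N₂) :
    Runs loadDiff (input A₁ A₂) (62 * (N₁ + N₂ + 1)) fun τ =>
      Loaded A₁ A₂ τ ∧ slice (N₁ + N₂) (τ.arr Arr.candidate) 0 = (A₁.diff A₂).init := by
  refine ((Runs.setReg (Q := fun τ => τ.reg Reg.dim = N₁ + N₂) rfl).seq fun τ hτ hd =>
    (Runs.concat (g₁ := A₁.final) (g₂ := -A₂.final) (hτ.reg_eq (by decide))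
      (hτ.reg_eq (by decide)) (fun i ρ hρ hi => ⟨by trivial, ?final₁⟩)
      fun i ρ hρ hi => ⟨by simp [RealExpr.Valid], ?final₂⟩).seq fun υ hυ hfinal =>
    (Runs.concat (g₁ := A₁.init) (g₂ := A₂.init)
      ((hυ.reg_eq (by decide)).trans (hτ.reg_eq (by decide)))
      ((hυ.reg_eq (by decide)).trans (hτ.reg_eq (by decide)))
      (fun i ρ hρ hi => ⟨by trivial, ?init₁⟩) fun i ρ hρ hi => ⟨by trivial, ?init₂⟩).mono le_rfl
    fun ω hω hinit => ⟨?loaded, hinit⟩).mono_cost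
      (by simp only [RealExpr.cost, NatExpr.cost]; linarith)
  case final₁ =>
    exact RealExpr.eval_cell_reg ((hρ.arr_eq (by decide)).trans (hτ.arr_eq (by decide))) hi
  case final₂ =>
    have hcell : (RealExpr.cell Arr.final₂ (.reg Reg.outer)).eval ρ = A₂.final i :=
      RealExpr.eval_cell_reg ((hρ.arr_eq (by decide)).trans (hτ.arr_eq (by decide))) hi
    rw [RealExpr.eval, hcell]
    simp [RealExpr.eval]
  case init₁ | init₂ =>
    exact RealExpr.eval_cell_reg ((hρ.arr_eq (by decide)).trans
      ((hυ.arr_eq (by decide)).trans (hτ.arr_eq (by decide)))) hi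
  case loaded =>
    have hσω : AgreeOff {Reg.dim, Reg.outer} {Arr.final, Arr.candidate} (input A₁ A₂) ω :=
      (hτ.mono (by decide) (by decide)).trans
        ((hυ.mono (by decide) (by decide)).trans (hω.mono (by decide) (by decide)))
    exact {
      alphabet_eq := hσω.reg_eq (by decide)
      states₁_eq := hσω.reg_eq (by decide)
      states₂_eq := hσω.reg_eq (by decide)
      dim_eq := (hω.reg_eq (by decide)).trans ((hυ.reg_eq (by decide)).trans hd)
      trans₁_eq := hσω.arr_eq (by decide)
      trans₂_eq := hσω.arr_eq (by decide)
      final_eq := by rw [hω.arr_eq (by decide), hfinal]; rfl }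

/-- Start the basis with the initial vector of the difference automaton. -/
def setup : Program :=
  .seq loadDiff insertCandidate

theorem Runs.setup (A₁ : Automaton k N₁) (A₂ : Automaton k N₂) :
    Runs setup (input A₁ A₂) (222 * (N₁ + N₂ + 1) ^ 2) fun τ =>
      Loaded A₁ A₂ τ ∧ Explored A₁ A₂ 0 τ := by
  refine ((Runs.loadDiff A₁ A₂).seq fun τ hτ ⟨hload, hinit⟩ =>
    (Runs.insertCandidate (n := 0) hload.dim_eq (hτ.reg_eq (by decide)) (.zero _) hinit).mono
      le_rfl fun υ hυ hins => ⟨hload.of_agreeOff hυ (by decide) (by decide),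
        .of_isInsertion_init hins⟩).mono_cost ?_
  linarith [Nat.le_self_pow two_ne_zero (N₁ + N₂ + 1)]

/-- Insert into the basis the image of its row `pivot` under the transition matrix of `letter`. -/
def insertImage : Program :=
  .seq image insertCandidate

theorem Runs.insertImage {σ : State} {n p : ℕ} {a : Fin k} (h : Loaded A₁ A₂ σ)
    (hn : σ.reg Reg.count = n) (hp : σ.reg Reg.pivot = p) (ha : σ.reg Reg.letter = a)
    (hb : IsOrthogonalBelow (rows (N₁ + N₂) (σ.arr Arr.basis)) n) :
    Runs insertImage σ (258 * (N₁ + N₂ + 1) ^ 2) fun τ =>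
      IsInsertion (rows (N₁ + N₂) (σ.arr Arr.basis)) n
        (rows (N₁ + N₂) (σ.arr Arr.basis) p ᵥ* (A₁.diff A₂).trans a)
        (rows (N₁ + N₂) (τ.arr Arr.basis)) (τ.reg Reg.count) := by
  refine ((Runs.image h hp ha).seq (T' := 160 * (N₁ + N₂ + 1) ^ 2) fun τ hτ hc => ?_).mono_cost
    (by linarith)
  have hbasis : τ.arr Arr.basis = σ.arr Arr.basis := hτ.arr_eq (by decide)
  rw [← hbasis] at hb hc ⊢
  exact Runs.insertCandidate ((hτ.reg_eq (by decide)).trans h.dim_eq)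
    ((hτ.reg_eq (by decide)).trans hn) hb hc

/-- Insert into the basis the images of its row `pivot` under all transition matrices. -/
def insertImages : Program :=
  forLoop Reg.letter Reg.alphabet insertImage

theorem Runs.insertImages {σ : State} {p : ℕ} (h : Loaded A₁ A₂ σ) (hp : σ.reg Reg.pivot = p)
    (hpn : p < σ.reg Reg.count) (hb : Explored A₁ A₂ p σ) :
    Runs insertImages σ (266 * (k + 1) * (N₁ + N₂ + 1) ^ 2) (Explored A₁ A₂ (p + 1)) := by
  let I (a : ℕ) (τ : State) : Prop :=
    Explored A₁ A₂ p τ ∧ p < τ.reg Reg.count ∧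
      ∀ a' : Fin k, a' < a → rows (N₁ + N₂) (τ.arr Arr.basis) p ᵥ* (A₁.diff A₂).trans a' ∈
        spanBelow (rows (N₁ + N₂) (τ.arr Arr.basis)) (τ.reg Reg.count)
  refine (Runs.forLoop (I := I) (T := 258 * (N₁ + N₂ + 1) ^ 2) h.alphabet_eq (by decide)
    (by decide) ⟨by exact hb, by exact hpn, by simp⟩ fun a ha τ hτ haτ ⟨hbτ, hpτ, himg⟩ =>
    (Runs.insertImage (a := ⟨a, ha⟩) (h.of_agreeOff hτ (by decide) (by decide)) rfl
      ((hτ.reg_eq (by decide)).trans hp) haτ hbτ.isOrthogonalBelow).mono le_rfl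
      fun υ _ hins => ?_).mono ?_ fun τ _ hI => hI.1.succ fun _ a => hI.2.2 a a.2
  · refine ⟨hbτ.insert hpτ.le ((A₁.diff A₂).vecMul_mem_forwardSpace
      (hbτ.spanBelow_le (mem_spanBelow hpτ)) _) hins, hpτ.trans_le hins.le, fun a' ha' => ?_⟩
    change rows _ (υ.arr Arr.basis) p ᵥ* _ ∈ spanBelow (rows _ (υ.arr Arr.basis)) (υ.reg Reg.count)
    rw [hins.eq_of_lt p hpτ]
    rcases Nat.lt_succ_iff_lt_or_eq.1 ha' with hlt | heq
    · exact hins.spanBelow_le (himg a' hlt)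
    · obtain rfl : a' = ⟨a, ha⟩ := Fin.ext heq
      exact hins.mem
  · have hD : 1 ≤ (N₁ + N₂ + 1) ^ 2 := Nat.one_le_pow _ _ (Nat.succ_pos _)
    calc (k + 1) * (258 * (N₁ + N₂ + 1) ^ 2 + 8)
        ≤ (k + 1) * (266 * (N₁ + N₂ + 1) ^ 2) := Nat.mul_le_mul_left _ (by omega)
      _ = 266 * (k + 1) * (N₁ + N₂ + 1) ^ 2 := by ring

/-- Insert into the basis the images of all its rows, including those that are added on the way. -/
def explore : Program :=
  forLoop Reg.pivot Reg.dim
    (.branch (.natLt (.reg Reg.pivot) (.reg Reg.count)) insertImages .skip)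

theorem Runs.explore {σ : State} (h : Loaded A₁ A₂ σ) (hb : Explored A₁ A₂ 0 σ) :
    Runs explore σ (278 * (k + 1) * (N₁ + N₂ + 1) ^ 3) (Explored A₁ A₂ (N₁ + N₂)) := by
  refine (Runs.forLoop (T := 4 + 266 * (k + 1) * (N₁ + N₂ + 1) ^ 2) (I := Explored A₁ A₂)
    h.dim_eq (by decide) (by decide) (by exact hb) fun p _ τ hτ hp hI =>
      Runs.branch (by trivial) (fun hlt => ?_) fun hlt => ?_).mono_cost ?_
  · simp only [Test.Holds, NatExpr.eval, hp] at hlt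
    exact Runs.insertImages (h.of_agreeOff hτ (by decide) (by decide)) hp hlt hI
  · simp only [Test.Holds, NatExpr.eval, hp] at hlt
    refine (Runs.skip ?_).mono_cost ?_
    · exact Automaton.IsExplored.succ hI fun hp => absurd hp hlt
    · have := Nat.one_le_pow 2 (N₁ + N₂ + 1) (Nat.succ_pos _)
      nlinarith
  · have hpos : 1 ≤ (k + 1) * (N₁ + N₂ + 1) ^ 2 := Nat.mul_pos k.succ_pos (by positivity)
    calc (N₁ + N₂ + 1) * (4 + 266 * (k + 1) * (N₁ + N₂ + 1) ^ 2 + 8)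
        ≤ (N₁ + N₂ + 1) * (278 * (k + 1) * (N₁ + N₂ + 1) ^ 2) :=
          Nat.mul_le_mul_left _ (by linarith)
      _ = 278 * (k + 1) * (N₁ + N₂ + 1) ^ 3 := by ring

/-- Answer no if a row of the basis is not orthogonal to the final weights. -/
def checkRow : Program :=
  .seq (dotInto 0 Arr.basis (rowAddr Reg.row) Arr.final (.lit 0))
    (.branch (.realEq (.cell Arr.scratch (.lit 0)) (.lit 0)) .skip (.setReg Reg.answer (.lit 0)))

theorem Runs.checkRow {σ : State} {d i : ℕ} {f : Fin d → ℝ} {q : Prop} (hd : σ.reg Reg.dim = d)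
    (hi : σ.reg Reg.row = i) (hf : slice d (σ.arr Arr.final) 0 = f) (hq : Answers σ q) :
    Runs checkRow σ (35 * (d + 1)) fun τ =>
      Answers τ (q ∧ rows d (σ.arr Arr.basis) i ⬝ᵥ f = 0) := by
  have hrow : (rowAddr Reg.row).eval σ = i * d := by simp [rowAddr, NatExpr.eval, hd, hi]
  refine ((Runs.dotInto hd (by decide) (by decide) (by decide) (by decide)).seq (T' := 8)
    fun τ hτ hdot => ?_).mono_cost (by simp only [rowAddr, NatExpr.cost]; linarith)
  have htest : (Test.realEq (.cell Arr.scratch (.lit 0)) (.lit 0)).Holds τ ↔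
      rows d (σ.arr Arr.basis) i ⬝ᵥ f = 0 := by
    simp [Test.Holds, RealExpr.eval, NatExpr.eval, hdot, hrow, hf, rows]
  have hans : τ.reg Reg.answer = σ.reg Reg.answer := hτ.reg_eq (by decide)
  refine Runs.mono_cost (Runs.branch (T := 2) (by simp [Test.Valid, RealExpr.Valid])
    (fun h0 => (Runs.skip ?_).mono_cost (by norm_num)) fun h0 => Runs.setReg (e := .lit 0) ?_)
    (by simp [Test.cost, RealExpr.cost, NatExpr.cost])
  · simpa [Answers, htest.1 h0, hans] using hq
  · exact .inr ⟨fun h => h0 (htest.2 h.2), State.setReg_reg_self ..⟩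

/-- Answer yes if and only if all rows of the basis are orthogonal to the final weights. -/
def finish : Program :=
  .seq (.setReg Reg.answer (.lit 1)) (forLoop Reg.row Reg.count checkRow)

theorem Runs.finish {σ : State} (h : Loaded A₁ A₂ σ) (hb : Explored A₁ A₂ (N₁ + N₂) σ) :
    Runs finish σ (45 * (N₁ + N₂ + 1) ^ 2) fun τ => Answers τ (A₁.Equivalent A₂) := by
  have hle : σ.reg Reg.count ≤ N₁ + N₂ :=
    hb.isOrthogonalBelow.le_card.trans_eq (Fintype.card_fin _)
  rw [Automaton.equivalent_iff_forall_wordProb_diff, hb.forall_wordProb_eq_zero_iff hle]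
  refine ((Runs.setReg (Q := fun τ => τ.reg Reg.answer = 1) rfl).seq fun τ hτ hans =>
    Runs.forLoop (T := 35 * (N₁ + N₂ + 1)) (I := fun i τ =>
        Answers τ (∀ j < i, rows (N₁ + N₂) (σ.arr Arr.basis) j ⬝ᵥ (A₁.diff A₂).final = 0))
      (hτ.reg_eq (by decide)) (by decide) (by decide) (by exact .inl ⟨by simp, hans⟩)
      fun i _ υ hυ hrow hI => ?_).mono_cost ?_
  · have hσυ : AgreeOff {Reg.answer, Reg.row, Reg.inner} {Arr.scratch} σ υ :=
      (hτ.mono (by decide) (by decide)).trans (hυ.mono (by decide) (by decide))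
    simp only [Nat.forall_lt_succ_right]
    rw [← hσυ.arr_eq (m := Arr.basis) (by decide)] at hI ⊢
    refine Runs.checkRow ((hσυ.reg_eq (by decide)).trans h.dim_eq) hrow ?_ hI
    rw [hσυ.arr_eq (by decide), h.final_eq]
  · simp only [NatExpr.cost]
    nlinarith

/-- Decide the equivalence of the two automata in the input. -/
def equivalenceTest : Program :=
  .seq setup (.seq explore finish)

theorem Runs.equivalenceTest (A₁ : Automaton k N₁) (A₂ : Automaton k N₂) :
    Runs equivalenceTest (input A₁ A₂) (545 * ((k + 1) * (N₁ + N₂ + 1) ^ 3)) fun τ =>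
      Answers τ (A₁.Equivalent A₂) := by
  refine ((Runs.setup A₁ A₂).seq fun σ _ ⟨hload, hb⟩ => (Runs.explore hload hb).seq
    fun τ hτ hb => Runs.finish (hload.of_agreeOff hτ (by decide) (by decide)) hb).mono_cost ?_
  have hD : (N₁ + N₂ + 1) ^ 2 ≤ (k + 1) * (N₁ + N₂ + 1) ^ 3 :=
    (Nat.pow_le_pow_right (Nat.succ_pos _) (by norm_num)).trans
      (Nat.le_mul_of_pos_left _ k.succ_pos)
  linarith

end RealRAM

theorem corollaryc_general :
    ∃ (P : RealRAM.Program) (C : ℕ), ∀ (k N₁ N₂ : ℕ)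
      (A₁ : Automaton k N₁) (A₂ : Automaton k N₂),
      ∃ (τ : RealRAM.State) (t : ℕ),
        RealRAM.Exec P (RealRAM.input A₁ A₂) τ t ∧
        RealRAM.Answers τ (A₁.Equivalent A₂) ∧
        t ≤ C * ((k + 1) * (N₁ + N₂ + 1) ^ 3) := by
  refine ⟨RealRAM.equivalenceTest, 545, fun k N₁ N₂ A₁ A₂ => ?_⟩
  obtain ⟨τ, t, hexec, ht, hanswer⟩ := RealRAM.Runs.equivalenceTest A₁ A₂
  exact ⟨τ, t, hexec, hanswer, ht⟩

theorem corollaryc :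
    ∃ (P : RealRAM.Program) (C : ℕ), ∀ (k N₁ N₂ : ℕ)
      (A₁ : Automaton k N₁) (A₂ : Automaton k N₂),
      A₁.IsProbabilistic → A₂.IsProbabilistic →
      ∃ (τ : RealRAM.State) (t : ℕ),
        RealRAM.Exec P (RealRAM.input A₁ A₂) τ t ∧
        RealRAM.Answers τ (A₁.Equivalent A₂) ∧
        t ≤ C * ((k + 1) * max N₁ N₂ ^ 4) := by
  obtain ⟨P, C, hP⟩ := corollaryc_general
  refine ⟨P, C * 27, fun k N₁ N₂ A₁ A₂ hA₁ _ => ?_⟩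
  obtain ⟨τ, t, hexec, hanswer, ht⟩ := hP k N₁ N₂ A₁ A₂
  refine ⟨τ, t, hexec, hanswer, ht.trans ?_⟩
  have hpos : 0 < max N₁ N₂ := hA₁.pos.trans_le (le_max_left _ _)
  have hdim : N₁ + N₂ + 1 ≤ 3 * max N₁ N₂ := by omega
  calc C * ((k + 1) * (N₁ + N₂ + 1) ^ 3)
      ≤ C * ((k + 1) * (3 * max N₁ N₂) ^ 3) := by gcongr
    _ = C * 27 * ((k + 1) * max N₁ N₂ ^ 3) := by ring
    _ ≤ C * 27 * ((k + 1) * max N₁ N₂ ^ 4) := by gcongr; omega
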